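/- \textbf{Theorem.} For a directed poset $P$ and a cardinal $\kappa$, say that $P$ has calibre $\kappa$ if every subset $T\subseteq P$ with $|T|=\kappa$ has a subset $T_0\subseteq T$ with $|T_0|=\kappa$ such that every $T_1\subseteq T_0$ with $|T_1|=\kappa$ has an upper bound in $P$; let $\mathrm{spec}(P)$ be the set of all (infinite) regular cardinals $\kappa$ such that $P$ does not have calibre $\kappa$. Give $\omega_1$ its order topology, let $\mathcal K(S)$ be the set of all compact subsets of a subspace $S\subseteq\omega_1$, ordered by inclusion, and let $\omega^\omega$ be the set of all functions $\omega\to\omega$ with the pointwise order. Let $S\subseteq\omega_1$ be unbounded, with closure $\overline S$ in $\omega_1$. (1) If $\overline S\setminus S$ is closed in $\omega_1$, then $\omega_1$ is the only uncountable cardinal in $\mathrm{spec}(\mathcal K(S))$, and $\omega\in\mathrm{spec}(\mathcal K(S))$ if and only if $S$ is not closed in $\omega_1$. (So $\mathrm{spec}(\mathcal K(S))=\{\omega_1\}$ if $S$ is closed, and $\mathrm{spec}(\mathcal K(S))=\{\omega,\omega_1\}$ if $S$ is not closed but $\overline S\setminus S$ is.) (2) If $\overline S\setminus S$ is not closed in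 $\omega_1$, then $\mathrm{spec}(\mathcal K(S))=\{\omega_1\}\cup\mathrm{spec}(\omega^\omega)$. -/

import Mathlib

open Cardinal Ordinal

namespace TukeySpectrum

/-- The space `ω₁` of all countable ordinals. -/
abbrev Omega1 : Type := (ω₁ : Ordinal.{0}).ToType

/-- `ω₁` carries its order topology. -/
noncomputable instance : TopologicalSpace Omega1 := Preorder.topology Omega1

instance : OrderTopology Omega1 := ⟨rfl⟩

/-- `P` has calibre `(κ, lam, μ)`: every `κ`-sized subset `T` of `P` has a `lam`-sized subset `T₀`
all of whose `μ`-sized subsets have an upper bound in `P`. -/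
def HasCalibre₃ (P : Type) [PartialOrder P] (κ lam μ : Cardinal.{0}) : Prop :=
  ∀ T : Set P, #T = κ → ∃ T₀ ⊆ T, #T₀ = lam ∧ ∀ T₁ ⊆ T₀, #T₁ = μ → BddAbove T₁

/-- `P` has calibre `κ`, that is, calibre `(κ, κ, κ)`. -/
def HasCalibre (P : Type) [PartialOrder P] (κ : Cardinal.{0}) : Prop :=
  HasCalibre₃ P κ κ κ

/-- The spectrum of `P`: the set of all (infinite) regular cardinals that are not calibres of
`P`. -/
def spec (P : Type) [PartialOrder P] : Set Cardinal.{0} :=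
  {κ | κ.IsRegular ∧ ¬ HasCalibre P κ}

end TukeySpectrum

open Set Filter Topology TopologicalSpace

namespace TukeySpectrum

/-! ### Calibres of indexed families and Tukey maps -/

section Calibre

variable {P Q : Type} [PartialOrder P] [PartialOrder Q] {κ : Cardinal.{0}}

/-! Singletons of points of `S` defeat calibre `ℵ₁`, as compact sets are countable. For regular `κ ≠
ℵ₁`, `κ` many compact sets include `κ` many inside one countable `Iic b`. There each compact set
records, at every point missing from `S`, the index of a basic neighbourhood it avoids: a function
in `ω^ω`, and a bound on these functions gives a compact bound. If the remainder `closure S \ S` is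
closed, finitely many closed neighbourhoods avoiding it cover each compact set, and only countably
many choices arise. If not, some `x ∈ S` is a limit of missing points `c n`, each the limit of a
sequence in `S`; adding to `x` initial segments of these sequences, of lengths given by `f`, embeds
`ω^ω` Tukey-wise (`exists_tukey_of_not_isClosed_diff`). -/

theorem hasCalibre_iff :
    HasCalibre P κ ↔ ∀ T : Set P, #T = κ → ∃ T₀ ⊆ T, #T₀ = κ ∧ BddAbove T₀ :=
  forall₂_congr fun _ _ ↦ exists_congr fun T₀ ↦ and_congr_right fun _ ↦ and_congr_right fun h ↦
    ⟨fun H ↦ H T₀ subset_rfl h, fun H _ h₁ _ ↦ H.mono h₁⟩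

/-- For regular `κ`, calibre `κ` may be tested on families indexed by a set of size `κ`. -/
theorem HasCalibre.exists_bddAbove_image (hP : HasCalibre P κ) (hκ : κ.IsRegular) {ι : Type}
    (hι : #ι = κ) (h : ι → P) : ∃ A : Set ι, #A = κ ∧ BddAbove (h '' A) := by
  -- With fewer than `κ` values, regularity makes some fibre have size `κ`.
  rcases (mk_range_le (f := h)).lt_or_eq with hlt | heq
  · obtain ⟨a, ha⟩ := infinite_pigeonhole (rangeFactorization h) (hι ▸ hκ.aleph0_le)
      (by rwa [hι, hκ.cof_ord, ← hι])
    refine ⟨_, ha.trans hι, a, ?_⟩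
    rintro _ ⟨i, hi, rfl⟩
    exact (congrArg Subtype.val (show rangeFactorization h i = a from hi)).le
  · obtain ⟨T₀, hT₀, hcard, hb⟩ := hasCalibre_iff.1 hP (range h) (heq.trans hι)
    obtain ⟨A, -, hA⟩ := (surjOn_iff_exists_bijOn_subset (f := h) (s := univ) (t := T₀)).1
      (by rwa [SurjOn, image_univ])
    refine ⟨A, (mk_congr hA.equiv).trans hcard, ?_⟩
    rwa [hA.image_eq]

/-- Calibres are inherited along Tukey maps. -/
theorem HasCalibre.of_tukey (hP : HasCalibre P κ) (hκ : κ.IsRegular) (h : Q → P)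
    (hh : ∀ A : Set Q, BddAbove (h '' A) → BddAbove A) : HasCalibre Q κ := by
  refine hasCalibre_iff.2 fun T hT ↦ ?_
  obtain ⟨A, hA, hb⟩ := hP.exists_bddAbove_image hκ hT fun t : T ↦ h t
  refine ⟨Subtype.val '' A, by simp, ?_, hh _ ?_⟩
  · rw [mk_image_eq Subtype.val_injective, hA]
  · rwa [image_image]

end Calibre

/-! ### Countable ordinals -/

section Omega1

theorem mk_omega1 : #Omega1 = ℵ₁ := by
  rw [Omega1, mk_toType, card_omega]

theorem countable_Iio (a : Omega1) : (Iio a).Countable := by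
  have h : #(Iio a) < #Omega1 :=
    mk_Iio_lt a (by rw [mk_omega1, ord_aleph, type_toType])
  rw [mk_omega1, ← succ_aleph0, Order.lt_succ_iff] at h
  exact le_aleph0_iff_set_countable.1 h

theorem countable_Iic (a : Omega1) : (Iic a).Countable := by
  rw [← Iio_insert]
  exact (countable_Iio a).insert a

theorem not_countable_omega1 : ¬ (univ : Set Omega1).Countable := by
  rw [← le_aleph0_iff_set_countable, mk_univ, mk_omega1, not_le]
  exact aleph0_lt_aleph_one

theorem bddAbove_of_countable {s : Set Omega1} (hs : s.Countable) : BddAbove s := by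
  by_contra h
  refine not_countable_omega1 ((hs.biUnion fun a _ ↦ countable_Iic a).mono fun x _ ↦ ?_)
  obtain ⟨y, hy, hxy⟩ := not_bddAbove_iff.1 h x
  exact mem_biUnion hy hxy.le

theorem countable_of_bddAbove {s : Set Omega1} (hs : BddAbove s) : s.Countable :=
  hs.elim fun b hb ↦ (countable_Iic b).mono hb

instance : Nonempty Omega1 := by
  rw [← mk_ne_zero_iff, mk_omega1]
  exact (aleph_pos _).ne'

instance : NoMaxOrder Omega1 :=
  ⟨fun a ↦ by
    by_contra! h
    exact not_countable_omega1 ((countable_Iic a).mono fun x _ ↦ h x)⟩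

theorem isCompact_Iic (b : Omega1) : IsCompact (Iic b) := by
  let : OrderBot Omega1 := WellFoundedLT.toOrderBot Omega1
  let : ConditionallyCompleteLinearOrderBot Omega1 :=
    WellFoundedLT.conditionallyCompleteLinearOrderBot Omega1
  rw [← Icc_bot]
  exact isCompact_Icc

theorem nhds_omega1 (a : Omega1) : 𝓝 a = (⨅ b : Iio a, 𝓟 (Ioi b.1)) ⊓ 𝓟 (Iic a) := by
  rw [nhds_eq_order, iInf_subtype']
  congr 1
  refine le_antisymm ?_ (le_iInf₂ fun b hb ↦ principal_mono.2 (Iic_subset_Iio.2 hb))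
  refine (iInf₂_le (Order.succ a) (Order.lt_succ a)).trans ?_
  rw [Order.Iio_succ]

instance : FirstCountableTopology Omega1 where
  nhds_generated_countable a := by
    have := (countable_Iio a).to_subtype
    rw [nhds_omega1]
    infer_instance

/-- A family of size `κ ≠ ℵ₁` of countable ordinals has a bounded subfamily of size `κ`. -/
theorem exists_bddAbove_subfamily {κ : Cardinal.{0}} (hκ : κ.IsRegular) (h1 : κ ≠ ℵ₁) {ι : Type}
    (hι : #ι = κ) (h : ι → Omega1) : ∃ b, ∃ A : Set ι, #A = κ ∧ ∀ i ∈ A, h i ≤ b := by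
  rcases hκ.aleph0_le.eq_or_lt with h0 | h0
  · have : Countable ι := mk_le_aleph0_iff.1 (hι.trans h0.symm).le
    obtain ⟨b, hb⟩ := bddAbove_of_countable (countable_range h)
    exact ⟨b, univ, mk_univ.trans hι, fun i _ ↦ hb (mem_range_self i)⟩
  · rw [← Order.succ_le_iff, succ_aleph0] at h0
    obtain ⟨b, hb⟩ := infinite_pigeonhole h (hι ▸ hκ.aleph0_le)
      (by rw [hι, hκ.cof_ord, mk_omega1]; exact h0.lt_of_ne h1.symm)
    exact ⟨b, _, hb.trans hι, fun i hi ↦ (show h i = b from hi).le⟩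

end Omega1

/-! ### Compact subsets of `S` -/

section Compacts

variable {S : Set Omega1}

theorem compacts_bddAbove_iff {A : Set (Compacts S)} :
    BddAbove A ↔ ∃ L : Set Omega1, IsCompact L ∧ L ⊆ S ∧
      ∀ K ∈ A, (Subtype.val '' (K : Set S)) ⊆ L := by
  constructor
  · rintro ⟨M, hM⟩
    refine ⟨Subtype.val '' (M : Set S), M.isCompact.image continuous_subtype_val, by simp, ?_⟩
    exact fun K hK ↦ image_mono (hM hK)
  · rintro ⟨L, hL, hLS, h⟩
    refine ⟨⟨Subtype.val ⁻¹' L, ?_⟩, fun K hK x hx ↦ h K hK (mem_image_of_mem _ hx)⟩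
    rwa [Subtype.isCompact_iff, Subtype.image_preimage_coe, inter_eq_right.2 hLS]

/-- The compact subset of the subspace `S` given by a compact set contained in `S`. -/
theorem exists_compacts_image_eq {L : Set Omega1} (hL : IsCompact L) (hLS : L ⊆ S) :
    ∃ K : Compacts S, Subtype.val '' (K : Set S) = L := by
  have h : Subtype.val '' (Subtype.val ⁻¹' L : Set S) = L := by
    rw [Subtype.image_preimage_coe, inter_eq_right.2 hLS]
  exact ⟨⟨Subtype.val ⁻¹' L, by rwa [Subtype.isCompact_iff, h]⟩, h⟩

/-- The singleton `{s}` as a compact set. -/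
def singletonCompact (s : S) : Compacts S := ⟨{s}, isCompact_singleton⟩

theorem singletonCompact_injective : Function.Injective (singletonCompact (S := S)) :=
  fun _ _ h ↦ singleton_injective (congrArg (fun K : Compacts S ↦ (K : Set S)) h)

theorem not_hasCalibre_of_points {κ : Cardinal.{0}} {B : Set S} (hB : #B = κ)
    (h : ∀ A ⊆ B, #A = κ → ∀ L : Set Omega1, IsCompact L → L ⊆ S → ¬ Subtype.val '' A ⊆ L) :
    ¬ HasCalibre (Compacts S) κ := by
  rw [hasCalibre_iff]
  intro H
  obtain ⟨T₀, hT₀, hcard, hb⟩ := H (singletonCompact '' B)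
    (by rw [mk_image_eq singletonCompact_injective, hB])
  obtain ⟨A, hA, rfl⟩ := subset_image_iff.1 hT₀
  obtain ⟨L, hL, hLS, hbd⟩ := compacts_bddAbove_iff.1 hb
  rw [mk_image_eq singletonCompact_injective] at hcard
  refine h A hA hcard L hL hLS ?_
  rintro _ ⟨a, ha, rfl⟩
  exact hbd _ (mem_image_of_mem _ ha) (mem_image_of_mem _ (mem_singleton a))

theorem aleph_one_mem_spec (hS : ¬ BddAbove S) : ℵ₁ ∈ spec (Compacts S) := by
  have hunc : ∀ A : Set S, #A = ℵ₁ → ¬ (Subtype.val '' A).Countable := by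
    intro A hA hc
    rw [← le_aleph0_iff_set_countable, mk_image_eq Subtype.val_injective, hA] at hc
    exact aleph0_lt_aleph_one.not_ge hc
  refine ⟨isRegular_aleph_one, not_hasCalibre_of_points (B := univ) ?_ fun A _ hA L hL _ hAL ↦
    hunc A hA (countable_of_bddAbove (hL.bddAbove.mono hAL))⟩
  rw [mk_univ]
  refine le_antisymm ((mk_set_le S).trans mk_omega1.le) ?_
  rw [← succ_aleph0, Order.succ_le_iff, ← not_le, le_aleph0_iff_set_countable]
  exact fun h ↦ hS (bddAbove_of_countable h)

theorem finite_setOf_mem_of_tendsto {s : ℕ → Omega1} {c : Omega1} (hs : Tendsto s atTop (𝓝 c))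
    {L : Set Omega1} (hL : IsCompact L) (hc : c ∉ L) : {n | s n ∈ L}.Finite := by
  have := hs.eventually (hL.isClosed.isOpen_compl.mem_nhds hc)
  rw [← Nat.cofinite_eq_atTop] at this
  simpa [eventually_cofinite] using this

theorem aleph0_mem_spec_of_not_isClosed (hS : ¬ IsClosed S) : ℵ₀ ∈ spec (Compacts S) := by
  obtain ⟨c, hc, hcS⟩ : ∃ c ∈ closure S, c ∉ S := by
    by_contra! h
    exact hS (isClosed_of_closure_subset h)
  obtain ⟨s, hsS, hs⟩ := mem_closure_iff_seq_limit.1 hc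
  have key : ∀ A : Set S, A ⊆ range (fun n ↦ (⟨s n, hsS n⟩ : S)) → ∀ L : Set Omega1,
      IsCompact L → L ⊆ S → Subtype.val '' A ⊆ L → A.Finite := by
    intro A hA L hL hLS hAL
    refine ((finite_setOf_mem_of_tendsto hs hL fun h ↦ hcS (hLS h)).image
      fun n ↦ (⟨s n, hsS n⟩ : S)).subset fun a ha ↦ ?_
    obtain ⟨n, rfl⟩ := hA ha
    exact ⟨n, hAL (mem_image_of_mem _ ha), rfl⟩
  -- A finite range is closed, so it would contain the limit `c`.
  have hinf : (range fun n ↦ (⟨s n, hsS n⟩ : S)).Infinite := by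
    intro hfin
    have hfin' : (range s).Finite := by
      refine (hfin.image Subtype.val).subset ?_
      rintro _ ⟨n, rfl⟩
      exact ⟨⟨s n, hsS n⟩, mem_range_self n, rfl⟩
    refine hcS ((range_subset_iff.2 hsS) (hfin'.isClosed.mem_of_tendsto hs ?_))
    exact Eventually.of_forall mem_range_self
  refine ⟨isRegular_aleph0, not_hasCalibre_of_points
    (B := range fun n ↦ (⟨s n, hsS n⟩ : S)) ?_ fun A hA hcard L hL hLS hAL ↦ ?_⟩
  · exact le_antisymm (le_aleph0_iff_set_countable.2 (countable_range _))
      (infinite_iff.1 hinf.to_subtype)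
  · have := (key A hA L hL hLS hAL).lt_aleph0
    exact this.ne hcard

/-- For regular `κ ≠ ℵ₁`, among `κ` many compact sets `κ` many lie in one initial segment. -/
theorem exists_subset_Iic {κ : Cardinal.{0}} (hκ : κ.IsRegular) (h1 : κ ≠ ℵ₁)
    {T : Set (Compacts S)} (hT : #T = κ) :
    ∃ b, ∃ T₀ ⊆ T, #T₀ = κ ∧ ∀ K ∈ T₀, (Subtype.val '' (K : Set S)) ⊆ Iic b := by
  choose g hg using fun K : T ↦ ((K : Compacts S).isCompact.image continuous_subtype_val).bddAbove
  obtain ⟨b, A, hA, hb⟩ := exists_bddAbove_subfamily hκ h1 hT g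
  refine ⟨b, Subtype.val '' A, by simp, by rw [mk_image_eq Subtype.val_injective, hA], ?_⟩
  rintro _ ⟨K, hK, rfl⟩ x hx
  exact (hg K hx).trans (hb K hK)

theorem not_mem_spec_of_isClosed (hS : IsClosed S) {κ : Cardinal.{0}} (h1 : κ ≠ ℵ₁) :
    κ ∉ spec (Compacts S) := by
  rintro ⟨hκ, h⟩
  refine h (hasCalibre_iff.2 fun T hT ↦ ?_)
  obtain ⟨b, T₀, hT₀, hcard, hb⟩ := exists_subset_Iic hκ h1 hT
  refine ⟨T₀, hT₀, hcard, compacts_bddAbove_iff.2 ⟨S ∩ Iic b, ?_, inter_subset_left, fun K hK ↦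
    subset_inter (by simp) (hb K hK)⟩⟩
  exact (isCompact_Iic b).inter_left hS

theorem not_mem_spec_of_isClosed_diff (hS : IsClosed (closure S \ S)) {κ : Cardinal.{0}}
    (h0 : ℵ₀ < κ) (h1 : κ ≠ ℵ₁) : κ ∉ spec (Compacts S) := by
  rintro ⟨hκ, h⟩
  refine h (hasCalibre_iff.2 fun T hT ↦ ?_)
  obtain ⟨b, T₀, hT₀, hcard, hb⟩ := exists_subset_Iic hκ h1 hT
  -- The value `∅` off `S` is a dummy.
  have hW : ∀ x : Omega1, ∃ W, IsClosed W ∧ (x ∈ S → W ∈ 𝓝 x ∧ W ⊆ (closure S \ S)ᶜ) := by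
    intro x
    by_cases hx : x ∈ S
    · obtain ⟨W, hW, hWc, hWs⟩ := exists_mem_nhds_isClosed_subset
        (hS.isOpen_compl.mem_nhds (show x ∈ (closure S \ S)ᶜ from fun h ↦ h.2 hx))
      exact ⟨W, hWc, fun _ ↦ ⟨hW, hWs⟩⟩
    · exact ⟨∅, isClosed_empty, fun h ↦ (hx h).elim⟩
  choose W hWc hW using hW
  classical
  have hcov : ∀ K : T₀, ∃ F : Finset ↥(S ∩ Iic b),
      Subtype.val '' ((K : Compacts S) : Set S) ⊆ ⋃ x ∈ F, W x := by
    intro K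
    have hKS : Subtype.val '' ((K : Compacts S) : Set S) ⊆ S := by simp
    obtain ⟨F, hF, hFW⟩ := ((K : Compacts S).isCompact.image
      continuous_subtype_val).elim_nhds_subcover W fun x hx ↦ (hW x (hKS hx)).1
    refine ⟨F.subtype (· ∈ S ∩ Iic b), fun x hx ↦ ?_⟩
    obtain ⟨y, hy, hxy⟩ := mem_iUnion₂.1 (hFW hx)
    exact mem_iUnion₂.2 ⟨⟨y, hKS (hF y hy), hb K K.2 (hF y hy)⟩, by simpa using hy, hxy⟩
  choose F hF using hcov
  have : Countable ↥(S ∩ Iic b) := ((countable_Iic b).mono inter_subset_right).to_subtype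
  -- A countable set has countably many finite subsets, so `κ` many compact sets share one cover.
  obtain ⟨F₀, hF₀⟩ := infinite_pigeonhole F (hcard ▸ hκ.aleph0_le)
    (by rw [hcard, hκ.cof_ord]; exact (mk_le_aleph0_iff.2 inferInstance).trans_lt h0)
  refine ⟨Subtype.val '' (F ⁻¹' {F₀}), (Subtype.coe_image_subset _ _).trans hT₀, ?_,
    compacts_bddAbove_iff.2 ⟨(closure S ∩ ⋃ x ∈ F₀, W x) ∩ Iic b, ?_, ?_, ?_⟩⟩
  · rw [mk_image_eq Subtype.val_injective, hF₀, hcard]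
  · exact (isCompact_Iic b).inter_left (isClosed_closure.inter
      (isClosed_biUnion_finset fun x _ ↦ hWc x))
  · rintro y ⟨⟨hy, hyW⟩, -⟩
    obtain ⟨x, hx, hyx⟩ := mem_iUnion₂.1 hyW
    by_contra hyS
    exact (hW x x.2.1).2 hyx ⟨hy, hyS⟩
  · rintro _ ⟨K, rfl, rfl⟩ y hy
    refine ⟨⟨subset_closure ?_, hF K hy⟩, hb K K.2 hy⟩
    obtain ⟨z, -, rfl⟩ := hy
    exact z.2

/-- Apart from `ℵ₁`, every regular calibre of `ω^ω` is a calibre of the compact subsets of `S`. -/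
theorem hasCalibre_compacts_of_nat {κ : Cardinal.{0}} (hκ : κ.IsRegular) (h1 : κ ≠ ℵ₁)
    (h : HasCalibre (ℕ → ℕ) κ) : HasCalibre (Compacts S) κ := by
  refine hasCalibre_iff.2 fun T hT ↦ ?_
  obtain ⟨b, T₀, hT₀, hcard, hb⟩ := exists_subset_Iic hκ h1 hT
  obtain ⟨e, he⟩ := (countable_Iic b).exists_eq_range nonempty_Iic
  choose U hU using fun c : Omega1 ↦ (nhds_basis_opens c).exists_antitone_subbasis
  have hm : ∀ K : T₀, ∀ n, ∃ m, e n ∉ S →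
      Disjoint (U (e n) m) (Subtype.val '' ((K : Compacts S) : Set S)) := by
    intro K n
    by_cases hn : e n ∈ S
    · exact ⟨0, fun h ↦ (h hn).elim⟩
    · have hc : IsClosed (Subtype.val '' ((K : Compacts S) : Set S)) :=
        ((K : Compacts S).isCompact.image continuous_subtype_val).isClosed
      obtain ⟨m, -, hm⟩ := (hU (e n)).2.toHasBasis.mem_iff.1
        (hc.isOpen_compl.mem_nhds (mem_compl fun ⟨z, _, hz⟩ ↦ hn (hz ▸ z.2)))
      exact ⟨m, fun _ ↦ subset_compl_iff_disjoint_right.1 hm⟩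
  choose f hf using hm
  obtain ⟨A, hA, g, hg⟩ := h.exists_bddAbove_image hκ hcard f
  -- The bound removes from `Iic b` an open neighbourhood of each missing point, hence is compact
  -- and inside `S`.
  refine ⟨Subtype.val '' A, (Subtype.coe_image_subset _ _).trans hT₀, ?_,
    compacts_bddAbove_iff.2 ⟨Iic b ∩ ⋂ n, ⋂ (_ : e n ∉ S), (U (e n) (g n))ᶜ, ?_, ?_, ?_⟩⟩
  · rw [mk_image_eq Subtype.val_injective, hA]
  · exact (isCompact_Iic b).inter_right (isClosed_iInter fun n ↦ isClosed_iInter fun _ ↦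
      ((hU (e n)).1 (g n)).2.isClosed_compl)
  · rintro y ⟨hyb, hy⟩
    by_contra hyS
    rw [he] at hyb
    obtain ⟨n, rfl⟩ := hyb
    exact mem_iInter₂.1 hy n hyS ((hU (e n)).1 (g n)).1
  · rintro _ ⟨K, hK, rfl⟩ y hy
    refine ⟨hb K K.2 hy, mem_iInter₂.2 fun n hn hyU ↦ ?_⟩
    exact disjoint_left.1 (hf K n hn)
      ((hU (e n)).2.antitone (hg (mem_image_of_mem f hK) n) hyU) hy

/-- If the remainder of `S` is not closed then `ω^ω` is Tukey below the compact subsets of `S`. -/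
theorem exists_tukey_of_not_isClosed_diff (hS : ¬ IsClosed (closure S \ S)) :
    ∃ h : (ℕ → ℕ) → Compacts S, ∀ A, BddAbove (h '' A) → BddAbove A := by
  obtain ⟨x, hx, hxC⟩ : ∃ x ∈ closure (closure S \ S), x ∉ closure S \ S := by
    by_contra! h
    exact hS (isClosed_of_closure_subset h)
  have hxS : x ∈ S := by
    by_contra h
    exact hxC ⟨closure_minimal sdiff_subset isClosed_closure hx, h⟩
  obtain ⟨U, hUo, hU⟩ := (nhds_basis_opens x).exists_antitone_subbasis
  choose c hcU hc using fun n ↦ mem_closure_iff.1 hx (U n) (hUo n).2 (hUo n).1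
  have hcl : ∀ n, c n ∈ closure (U n ∩ S) := fun n ↦
    (hUo n).2.inter_closure ⟨hcU n, (hc n).1⟩
  choose s hsU hs using fun n ↦ mem_closure_iff_seq_limit.1 (hcl n)
  -- The `+ 1` puts `s n (f n)` itself into the set, so that `f n` can be recovered.
  have hcomp : ∀ f : ℕ → ℕ, IsCompact
      (insert x (range fun p : Σ n, Fin (f n + 1) ↦ s p.1 p.2)) := by
    intro f
    refine Tendsto.isCompact_insert_range_of_cofinite (hU.tendsto_right_iff.2 fun n _ ↦ ?_)
    have hfin : (⋃ k ∈ Iio n, range fun i : Fin (f k + 1) ↦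
        (⟨k, i⟩ : Σ n, Fin (f n + 1))).Finite :=
      (finite_Iio n).biUnion fun k _ ↦ finite_range _
    refine hfin.subset ?_
    rintro ⟨k, i⟩ hk
    refine mem_iUnion₂.2 ⟨k, ?_, i, rfl⟩
    by_contra hkn
    exact hk (hU.antitone (not_lt.1 hkn) (hsU k i).1)
  have hsub : ∀ f : ℕ → ℕ, insert x (range fun p : Σ n, Fin (f n + 1) ↦ s p.1 p.2) ⊆ S :=
    fun f ↦ insert_subset hxS (range_subset_iff.2 fun p ↦ (hsU p.1 p.2).2)
  choose h hh using fun f ↦ exists_compacts_image_eq (hcomp f) (hsub f)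
  refine ⟨h, fun A hA ↦ ?_⟩
  obtain ⟨L, hL, hLS, hbd⟩ := compacts_bddAbove_iff.1 hA
  -- As `c n ∉ L`, only finitely many terms of `s n` lie in `L`; `g n` bounds their indices.
  choose g hg using fun n ↦
    (finite_setOf_mem_of_tendsto (hs n) hL fun hn ↦ (hc n).2 (hLS hn)).bddAbove
  refine ⟨g, fun f hf n ↦ hg n (hbd _ (mem_image_of_mem h hf) ?_)⟩
  rw [hh]
  exact mem_insert_of_mem _ ⟨⟨n, Fin.last (f n)⟩, by simp⟩

end Compacts

end TukeySpectrum

/-- `TopologicalSpace.Compacts S` is the set of all compact subsets of the subspace `S`, ordered by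
inclusion, and `ℕ → ℕ` carries the pointwise order. -/
theorem mainTheorem8 (S : Set TukeySpectrum.Omega1) (hS : ¬ BddAbove S) :
    (IsClosed (closure S \ S) →
      {κ ∈ TukeySpectrum.spec (TopologicalSpace.Compacts S) | ℵ₀ < κ} = {ℵ₁} ∧
      (ℵ₀ ∈ TukeySpectrum.spec (TopologicalSpace.Compacts S) ↔ ¬ IsClosed S)) ∧
    (¬ IsClosed (closure S \ S) →
      TukeySpectrum.spec (TopologicalSpace.Compacts S) = {ℵ₁} ∪ TukeySpectrum.spec (ℕ → ℕ)) := by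
  have hω₁ := TukeySpectrum.aleph_one_mem_spec hS
  refine ⟨fun hC ↦ ⟨Set.ext fun κ ↦ ⟨?_, ?_⟩, ?_, ?_⟩, fun hC ↦ Set.ext fun κ ↦ ⟨?_, ?_⟩⟩
  · rintro ⟨hκ, h0⟩
    by_contra h1
    exact TukeySpectrum.not_mem_spec_of_isClosed_diff hC h0 h1 hκ
  · rintro rfl
    exact ⟨hω₁, aleph0_lt_aleph_one⟩
  · exact fun h hcl ↦ TukeySpectrum.not_mem_spec_of_isClosed hcl aleph0_lt_aleph_one.ne h
  · exact TukeySpectrum.aleph0_mem_spec_of_not_isClosed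
  · rintro ⟨hκ, h⟩
    by_cases h1 : κ = ℵ₁
    · exact Or.inl h1
    · exact Or.inr ⟨hκ, fun hn ↦ h (TukeySpectrum.hasCalibre_compacts_of_nat hκ h1 hn)⟩
  · rintro (rfl | ⟨hκ, h⟩)
    · exact hω₁
    · obtain ⟨f, hf⟩ := TukeySpectrum.exists_tukey_of_not_isClosed_diff hC
      exact ⟨hκ, fun hn ↦ h (hn.of_tukey hκ f hf)⟩
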